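/- Let $q\ge 2$ be an integer and let $\mathfrak X$ be the homogeneous tree of degree $q+1$ (a connected graph without circuits in which every vertex has exactly $q+1$ neighbours), with graph distance $d$, a fixed vertex $o$, and $|x|=d(o,x)$. Let $\mathcal L f(x)=f(x)-\frac1{q+1}\sum_{y:\,d(x,y)=1}f(y)$. Let $\mathcal S_2(\mathfrak X)$ be the space of all $f:\mathfrak X\to\mathbb C$ with $\nu_m(f)=\sup_{x\in\mathfrak X}(1+|x|)^m q^{|x|/2}|f(x)|<\infty$ for all $m\in\mathbb N$, with the topology defined by the seminorms $\nu_m$. An $L^2$-tempered distribution is a continuous linear functional $T:\mathcal S_2(\mathfrak X)\to\mathbb C$, and $\mathcal LT$ is defined by $\langle\mathcal LT,\phi\rangle=\langle T,\mathcal L\phi\rangle$. **Lemma A.** Let $\{T_k\}_{k\in\mathbb Z}$ be a doubly infinite sequence of $L^2$-tempered distributions on $\mathfrak X$ such that 1. $\mathcal LT_k=z_0T_{k+1}$ for all $k\in\mathbb Z$, for some non-zero $z_0\in\mathbb C$ that does not depend on $k$, and 2. $|\langle T_k,\phi\rangle|\le M\,\nu(\phi)$ for all $k\in\mathbb Z$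 and all $\phi\in\mathcal S_2(\mathfrak X)$, where $M>0$ and $\nu$ is a continuous seminorm on $\mathcal S_2(\mathfrak X)$, both independent of $k$ and $\phi$. Put $b=\frac{2\sqrt q}{q+1}$. Then: (a) if $|z_0|\in[1-b,1+b]$, then $\mathcal LT_0=|z_0|T_0$; (b) if $|z_0|\notin[1-b,1+b]$, then $T_k=0$ for all $k\in\mathbb Z$. -/

import Mathlib

open Filter Topology

noncomputable section

namespace HomogeneousTree

/-- `G` is the homogeneous tree of degree `q + 1`, where `q ≥ 2`: a connected graph without circuits
in which every vertex has exactly `q + 1` neighbours. -/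
structure IsHomogeneousTree {V : Type*} (G : SimpleGraph V) [G.LocallyFinite] (q : ℕ) : Prop where
  isTree : G.IsTree
  regular : G.IsRegularOfDegree (q + 1)
  two_le : 2 ≤ q

/-- The Laplacian `𝓛 f (x) = f (x) - (q + 1)⁻¹ ∑_{d(x,y) = 1} f (y)` on all complex functions
on the vertices. -/
def laplacian {V : Type*} (G : SimpleGraph V) [G.LocallyFinite] (q : ℕ) :
    (V → ℂ) →ₗ[ℂ] (V → ℂ) where
  toFun f x := f x - 1 / ((q : ℂ) + 1) * ∑ y ∈ G.neighborFinset x, f y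
  map_add' f g := by
    funext x
    simp only [Pi.add_apply, Finset.sum_add_distrib]
    ring
  map_smul' c f := by
    funext x
    simp only [Pi.smul_apply, smul_eq_mul, RingHom.id_apply, ← Finset.mul_sum]
    ring

section Schwartz

variable {V : Type*}

/-- The weight `(1 + |x|) ^ m q ^ (|x| / 2)`, where `|x| = d(o, x)`. -/
def weight (G : SimpleGraph V) (q : ℕ) (o : V) (m : ℕ) (x : V) : ℝ :=
  (1 + (G.dist o x : ℝ)) ^ m * (q : ℝ) ^ ((G.dist o x : ℝ) / 2)

theorem weight_nonneg (G : SimpleGraph V) (q : ℕ) (o : V) (m : ℕ) (x : V) :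
    0 ≤ weight G q o m x := by
  unfold weight
  positivity

/-- The functions `f` with `sup_x (1 + |x|) ^ m q ^ (|x| / 2) |f (x)| < ∞` for all `m`,
as a subspace of all functions. -/
def schwartzSubmodule (G : SimpleGraph V) (q : ℕ) (o : V) : Submodule ℂ (V → ℂ) where
  carrier := {f | ∀ m : ℕ, BddAbove (Set.range fun x => weight G q o m x * ‖f x‖)}
  zero_mem' := by
    intro m
    refine ⟨0, ?_⟩
    rintro _ ⟨x, rfl⟩
    simp
  add_mem' := by
    intro f g hf hg m
    obtain ⟨A, hA⟩ := hf m
    obtain ⟨B, hB⟩ := hg m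
    refine ⟨A + B, ?_⟩
    rintro _ ⟨x, rfl⟩
    have h1 := hA ⟨x, rfl⟩
    have h2 := hB ⟨x, rfl⟩
    have h3 := mul_le_mul_of_nonneg_left (norm_add_le (f x) (g x)) (weight_nonneg G q o m x)
    simp only [Pi.add_apply] at h1 h2 h3 ⊢
    linarith
  smul_mem' := by
    intro c f hf m
    obtain ⟨A, hA⟩ := hf m
    refine ⟨‖c‖ * A, ?_⟩
    rintro _ ⟨x, rfl⟩
    have h1 := mul_le_mul_of_nonneg_left (hA ⟨x, rfl⟩) (norm_nonneg c)
    simp only [Pi.smul_apply, smul_eq_mul, norm_mul] at h1 ⊢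
    linarith

/-- The Schwartz space `𝒮₂(𝔛)`. It is a type of its own, so that it carries the topology of its
seminorms and not that of pointwise convergence. -/
def SchwartzSpace (G : SimpleGraph V) (q : ℕ) (o : V) : Type _ :=
  ↥(schwartzSubmodule G q o)

namespace SchwartzSpace

variable {G : SimpleGraph V} {q : ℕ} {o : V}

instance : AddCommGroup (SchwartzSpace G q o) :=
  inferInstanceAs (AddCommGroup ↥(schwartzSubmodule G q o))

instance : Module ℂ (SchwartzSpace G q o) :=
  inferInstanceAs (Module ℂ ↥(schwartzSubmodule G q o))

/-- A Schwartz function as a function on the vertices. -/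
def toFun : SchwartzSpace G q o →ₗ[ℂ] (V → ℂ) := (schwartzSubmodule G q o).subtype

theorem bddAbove (f : SchwartzSpace G q o) (m : ℕ) :
    BddAbove (Set.range fun x => weight G q o m x * ‖toFun f x‖) := f.2 m

variable (G q o) in
/-- The seminorm `ν_m (f) = sup_x (1 + |x|) ^ m q ^ (|x| / 2) |f (x)|`. -/
def nu (m : ℕ) : Seminorm ℂ (SchwartzSpace G q o) :=
  Seminorm.of (fun f => ⨆ x, weight G q o m x * ‖toFun f x‖)
    (by
      intro f g
      have : Nonempty V := ⟨o⟩
      refine ciSup_le fun x => ?_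
      have h1 := le_ciSup (bddAbove f m) x
      have h2 := le_ciSup (bddAbove g m) x
      have h3 := mul_le_mul_of_nonneg_left (norm_add_le (toFun f x) (toFun g x))
        (weight_nonneg G q o m x)
      simp only [map_add, Pi.add_apply] at h1 h2 h3 ⊢
      linarith)
    (by
      intro c f
      rw [Real.mul_iSup_of_nonneg (norm_nonneg c)]
      congr 1
      funext x
      simp only [map_smul, Pi.smul_apply, smul_eq_mul, norm_mul]
      ring)

theorem nu_apply (m : ℕ) (f : SchwartzSpace G q o) :
    nu G q o m f = ⨆ x, weight G q o m x * ‖toFun f x‖ := rfl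

variable (G q o) in
/-- The seminorms `ν_m`, as a family. -/
def nuFamily : SeminormFamily ℂ (SchwartzSpace G q o) ℕ := fun m => nu G q o m

/-- The locally convex topology of `𝒮₂(𝔛)`, defined by the seminorms `ν_m`. -/
instance : TopologicalSpace (SchwartzSpace G q o) :=
  (nuFamily G q o).moduleFilterBasis.topology

theorem withSeminorms : WithSeminorms (nuFamily G q o) := ⟨rfl⟩

instance : IsTopologicalAddGroup (SchwartzSpace G q o) := withSeminorms.topologicalAddGroup

instance : ContinuousSMul ℂ (SchwartzSpace G q o) := withSeminorms.continuousSMul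

/-- A linear functional on `𝒮₂(𝔛)` is continuous if and only if `⟨T, f_n⟩ → 0` whenever
`ν_m (f_n) → 0` for all `m`. -/
theorem continuous_iff_seq (T : SchwartzSpace G q o →ₗ[ℂ] ℂ) :
    Continuous T ↔ ∀ f : ℕ → SchwartzSpace G q o,
      (∀ m, Tendsto (fun n => nu G q o m (f n)) atTop (𝓝 0)) →
        Tendsto (fun n => T (f n)) atTop (𝓝 0) := by
  have : FirstCountableTopology (SchwartzSpace G q o) :=
    withSeminorms.firstCountableTopology
  have key : ∀ f : ℕ → SchwartzSpace G q o,
      (∀ m, Tendsto (fun n => nu G q o m (f n)) atTop (𝓝 0)) ↔ Tendsto f atTop (𝓝 0) := by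
    intro f
    rw [withSeminorms.tendsto_nhds f 0]
    refine forall_congr' fun m => ?_
    rw [Metric.tendsto_nhds]
    refine forall_congr' fun ε => imp_congr_right fun _ => ?_
    simp [nuFamily, abs_of_nonneg, apply_nonneg]
  constructor
  · intro h f hf
    have := (h.tendsto 0).comp ((key f).1 hf)
    rwa [map_zero] at this
  · intro h
    refine continuous_of_continuousAt_zero T ?_
    refine tendsto_of_seq_tendsto fun f hf => ?_
    rw [map_zero]
    exact h f ((key f).2 hf)

end SchwartzSpace

section Laplacian

variable {G : SimpleGraph V} [G.LocallyFinite] {q : ℕ}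

theorem weight_adj_le (hG : IsHomogeneousTree G q) (o : V) (m : ℕ) {x y : V} (h : G.Adj x y) :
    weight G q o m x ≤ 2 ^ m * q * weight G q o m y := by
  have hq : (1 : ℝ) ≤ q := by exact_mod_cast le_trans one_le_two hG.two_le
  have hd : (G.dist o x : ℝ) ≤ G.dist o y + 1 := by
    have h1 := hG.isTree.connected.dist_triangle (u := o) (v := y) (w := x)
    rw [SimpleGraph.dist_eq_one_iff_adj.2 h.symm] at h1
    exact_mod_cast h1
  have hy : (0 : ℝ) ≤ G.dist o y := Nat.cast_nonneg _
  have h1 : (1 + (G.dist o x : ℝ)) ^ m ≤ 2 ^ m * (1 + (G.dist o y : ℝ)) ^ m := by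
    rw [← mul_pow]
    exact pow_le_pow_left₀ (by positivity) (by linarith) m
  have h2 : (q : ℝ) ^ ((G.dist o x : ℝ) / 2) ≤ q * (q : ℝ) ^ ((G.dist o y : ℝ) / 2) := by
    calc (q : ℝ) ^ ((G.dist o x : ℝ) / 2)
        ≤ (q : ℝ) ^ (1 + (G.dist o y : ℝ) / 2) :=
          Real.rpow_le_rpow_of_exponent_le hq (by linarith)
      _ = _ := by rw [Real.rpow_add (by linarith), Real.rpow_one]
  unfold weight
  calc _ ≤ (2 ^ m * (1 + (G.dist o y : ℝ)) ^ m) * (q * (q : ℝ) ^ ((G.dist o y : ℝ) / 2)) :=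
        mul_le_mul h1 h2 (by positivity) (by positivity)
    _ = _ := by ring

theorem weight_laplacian_le (hG : IsHomogeneousTree G q) {o : V} (m : ℕ)
    (f : SchwartzSpace G q o) (x : V) :
    weight G q o m x * ‖laplacian G q f.toFun x‖
      ≤ (1 + 2 ^ m * q) * SchwartzSpace.nu G q o m f := by
  have hb : ∀ y, weight G q o m y * ‖f.toFun y‖ ≤ SchwartzSpace.nu G q o m f :=
    fun y => le_ciSup (f.bddAbove m) y
  have hw := weight_nonneg G q o m x
  have hsum : weight G q o m x * ‖∑ y ∈ G.neighborFinset x, f.toFun y‖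
      ≤ (q + 1) * (2 ^ m * q * SchwartzSpace.nu G q o m f) := by
    calc _ ≤ weight G q o m x * ∑ y ∈ G.neighborFinset x, ‖f.toFun y‖ :=
          mul_le_mul_of_nonneg_left (norm_sum_le _ _) hw
      _ = ∑ y ∈ G.neighborFinset x, weight G q o m x * ‖f.toFun y‖ := Finset.mul_sum _ _ _
      _ ≤ ∑ y ∈ G.neighborFinset x, 2 ^ m * q * SchwartzSpace.nu G q o m f := by
          refine Finset.sum_le_sum fun y hy => ?_
          have hxy : G.Adj x y := by simpa using hy
          have h1 := mul_le_mul_of_nonneg_right (weight_adj_le hG o m hxy) (norm_nonneg (f.toFun y))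
          have h2 := mul_le_mul_of_nonneg_left (hb y) (by positivity : (0 : ℝ) ≤ 2 ^ m * q)
          linarith
      _ = _ := by
          rw [Finset.sum_const, SimpleGraph.card_neighborFinset_eq_degree, hG.regular x,
            nsmul_eq_mul]
          push_cast
          ring
  have hn : ‖1 / ((q : ℂ) + 1)‖ = 1 / ((q : ℝ) + 1) := by
    have h : (q : ℂ) + 1 = ((q + 1 : ℕ) : ℂ) := by push_cast; rfl
    rw [norm_div, norm_one, h, Complex.norm_natCast]
    push_cast
    rfl
  have hq : (0 : ℝ) < q + 1 := by positivity
  calc weight G q o m x * ‖laplacian G q f.toFun x‖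
      ≤ weight G q o m x * (‖f.toFun x‖
          + 1 / ((q : ℝ) + 1) * ‖∑ y ∈ G.neighborFinset x, f.toFun y‖) := by
        refine mul_le_mul_of_nonneg_left ?_ hw
        refine (norm_sub_le _ _).trans ?_
        rw [norm_mul, hn]
    _ = weight G q o m x * ‖f.toFun x‖
          + 1 / ((q : ℝ) + 1) * (weight G q o m x * ‖∑ y ∈ G.neighborFinset x, f.toFun y‖) := by
        ring
    _ ≤ SchwartzSpace.nu G q o m f
          + 1 / ((q : ℝ) + 1) * ((q + 1) * (2 ^ m * q * SchwartzSpace.nu G q o m f)) :=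
        add_le_add (hb x) (mul_le_mul_of_nonneg_left hsum (by positivity))
    _ = _ := by
        field_simp

/-- The Laplacian as a continuous operator on `𝒮₂(𝔛)`. -/
def schwartzLaplacian (hG : IsHomogeneousTree G q) (o : V) :
    SchwartzSpace G q o →L[ℂ] SchwartzSpace G q o where
  toLinearMap := LinearMap.codRestrict (schwartzSubmodule G q o)
    ((laplacian G q).comp SchwartzSpace.toFun) (by
      intro f m
      refine ⟨(1 + 2 ^ m * q) * SchwartzSpace.nu G q o m f, ?_⟩
      rintro _ ⟨x, rfl⟩
      exact weight_laplacian_le hG m f x)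
  cont := by
    refine WithSeminorms.continuous_of_isBounded SchwartzSpace.withSeminorms
      SchwartzSpace.withSeminorms _ ?_
    intro m
    refine ⟨{m}, ⟨1 + 2 ^ m * q, by positivity⟩, ?_⟩
    intro f
    have : Nonempty V := ⟨o⟩
    simp only [Finset.sup_singleton]
    exact ciSup_le fun x => weight_laplacian_le hG m f x

theorem schwartzLaplacian_toFun (hG : IsHomogeneousTree G q) (o : V) (f : SchwartzSpace G q o) :
    (schwartzLaplacian hG o f).toFun = laplacian G q f.toFun := rfl

end Laplacian

/-- `L²`-tempered distributions: the continuous linear functionals on `𝒮₂(𝔛)`; continuity is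
sequential continuity for the seminorms `ν_m`, by `SchwartzSpace.continuous_iff_seq`. -/
abbrev TemperedDistribution (G : SimpleGraph V) (q : ℕ) (o : V) : Type _ :=
  SchwartzSpace G q o →L[ℂ] ℂ

/-- The Laplacian of a distribution, `⟨𝓛T, φ⟩ = ⟨T, 𝓛φ⟩`. -/
def TemperedDistribution.laplacian {G : SimpleGraph V} [G.LocallyFinite] {q : ℕ}
    (hG : IsHomogeneousTree G q) {o : V} (T : TemperedDistribution G q o) :
    TemperedDistribution G q o :=
  T.comp (schwartzLaplacian hG o)

end Schwartz

end HomogeneousTree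

end

/-! ### Gelfand's theorem on isometries with spectrum `{1}` -/

/-! Put r = |z₀| and c = z₀ / r, so that the rotated distributions c ^ k T_k satisfy 𝓛(c ^ k T_k) =
r c ^ (k + 1) T_(k + 1); statement (a) then says that c ^ k T_k does not depend on k. Let X = (1 -
𝓛) / b, which is A / (2 √q) for the adjacency operator A. Two facts about X meet.

On the tree, the seminorms of U_n(X) φ grow only polynomially in |n| (`seminorm_chebyshevU_le`):
`walkSum` is a positive operator, and a Schwartz function is dominated by a multiple of the positive
spherical function at the edge of the spectrum, where U_n takes the value n + 1. Hence v k n = c ^ k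
⟨T_k, U_n(X) φ⟩ is of polynomial growth in n, uniformly in k.

The rest concerns such arrays alone (`recurrence_rigidity`). On the Banach space of arrays of this
growth obeying the Chebyshev recurrence, the shift S in k is an invertible isometry, and (1 - r S) /
b averages the two unit shifts in n, so its Chebyshev polynomials T_m have polynomially bounded
norm. If z is in the spectrum of S, then |z| = 1 and T_m((1 - r z) / b) grows polynomially, which
forces (1 - r z) / b into [-1, 1]. As b < 1, r z is a positive real, whence z = 1 and r ∈ [1 - b, 1
+ b]. Gelfand's theorem (`eq_one_of_spectrum_subset`) turns spectrum {1} into S = 1; for other r the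
spectrum is empty and the space is zero. Taking n = 0 returns to the T_k. -/

theorem nonpos_of_forall_le_div {a C : ℝ} (h : ∀ R : ℝ, 1 ≤ R → a ≤ C / R) : a ≤ 0 := by
  have ht : Tendsto (fun R : ℝ => C / R) atTop (𝓝 0) := tendsto_const_nhds.div_atTop tendsto_id
  exact ge_of_tendsto ht (eventually_atTop.2 ⟨1, h⟩)

/-- On the circle `|t| = R`, the polynomial `1 + (t + t²) / R²` compensates the growth of
`1 / ||t + 1| - |t||`. -/
theorem norm_one_add_div_sq_le {t : ℂ} {R : ℝ} (hR : 1 ≤ R) (ht : ‖t‖ = R) :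
    ‖1 + (t + t ^ 2) / (R : ℂ) ^ 2‖ ≤ 3 * |‖t + 1‖ - ‖t‖| := by
  have hR0 : 0 < R := by linarith
  have hRC : (R : ℂ) ≠ 0 := by exact_mod_cast hR0.ne'
  have h1 : (R : ℂ) ^ 2 = t * (starRingEnd ℂ) t := by
    rw [Complex.mul_conj, Complex.normSq_eq_norm_sq, ht]
    push_cast
    rfl
  have h2 : ((‖t + 1‖ ^ 2 - ‖t‖ ^ 2 : ℝ) : ℂ) = (starRingEnd ℂ) t + 1 + t := by
    rw [← Complex.normSq_eq_norm_sq, ← Complex.normSq_eq_norm_sq]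
    push_cast
    rw [← Complex.mul_conj, ← Complex.mul_conj, map_add, map_one]
    ring
  have h3 : (1 + (t + t ^ 2) / (R : ℂ) ^ 2) * (R : ℂ) ^ 2
      = t * ((‖t + 1‖ ^ 2 - ‖t‖ ^ 2 : ℝ) : ℂ) := by
    rw [h2, add_mul, div_mul_cancel₀ _ (pow_ne_zero 2 hRC), h1]
    ring
  have h4 := congrArg norm h3
  rw [norm_mul, norm_mul, Complex.norm_real, Real.norm_eq_abs, norm_pow, Complex.norm_real,
    Real.norm_eq_abs, abs_of_pos hR0, ht, sq_sub_sq, abs_mul,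
    abs_of_nonneg (by positivity : 0 ≤ ‖t + 1‖ + R)] at h4
  have h5 : ‖t + 1‖ ≤ R + 1 := by
    have := norm_add_le t 1
    rwa [ht, norm_one] at this
  rw [ht]
  have h6 : ‖1 + (t + t ^ 2) / (R : ℂ) ^ 2‖ * R = (‖t + 1‖ + R) * |‖t + 1‖ - R| := by
    have : (‖1 + (t + t ^ 2) / (R : ℂ) ^ 2‖ * R) * R
        = ((‖t + 1‖ + R) * |‖t + 1‖ - R|) * R := by linarith
    exact mul_right_cancel₀ hR0.ne' this
  have h7 : (‖t + 1‖ + R) * |‖t + 1‖ - R| ≤ (3 * R) * |‖t + 1‖ - R| :=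
    mul_le_mul_of_nonneg_right (by linarith) (abs_nonneg _)
  refine le_of_mul_le_mul_right ?_ hR0
  linarith

section Gelfand

variable {A : Type*} [NormedRing A]

theorem norm_one_le_of_unit (S : Aˣ) (hS : ‖(S : A)‖ ≤ 1) (hS' : ‖((S⁻¹ : Aˣ) : A)‖ ≤ 1) :
    ‖(1 : A)‖ ≤ 1 := by
  rw [← S.mul_inv]
  exact (norm_mul_le _ _).trans (mul_le_one₀ hS (norm_nonneg _) hS')

variable [NormedAlgebra ℂ A]

/-- Both `S` and its inverse are contractions, so left multiplication by `S` preserves norms and the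
reverse triangle inequality applies. With u = t + 1 this bounds the resolvent off the line |t + 1| =
|t|. -/
theorem abs_norm_sub_norm_mul_le (S : Aˣ) (hS : ‖(S : A)‖ ≤ 1) (hS' : ‖((S⁻¹ : Aˣ) : A)‖ ≤ 1)
    (u t : ℂ) (y : A) : |‖u‖ - ‖t‖| * ‖y‖ ≤ ‖u • y - t • ((S : A) * y)‖ := by
  have h1 : ‖(S : A) * y‖ ≤ ‖y‖ :=
    (norm_mul_le _ _).trans (mul_le_of_le_one_left (norm_nonneg _) hS)
  have h2 : ‖y‖ ≤ ‖(S : A) * y‖ := by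
    calc ‖y‖ = ‖((S⁻¹ : Aˣ) : A) * ((S : A) * y)‖ := by rw [Units.inv_mul_cancel_left]
      _ ≤ _ := (norm_mul_le _ _).trans (mul_le_of_le_one_left (norm_nonneg _) hS')
  have h3 := abs_norm_sub_norm_le (u • y) (t • ((S : A) * y))
  rw [norm_smul, norm_smul, le_antisymm h1 h2, ← sub_mul, abs_mul, abs_of_nonneg (norm_nonneg y)]
    at h3
  exact h3

/-- For t ≠ 0 the element is t (t⁻¹ + 1 - S), and t⁻¹ + 1 ≠ 1. Thus the inverse is an entire
function of t. -/
theorem isUnit_one_sub_smul (S : A) (hσ : spectrum ℂ S ⊆ {1}) (t : ℂ) :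
    IsUnit (1 - t • (S - 1)) := by
  by_cases ht : t = 0
  · simp [ht]
  have h1 : t⁻¹ + 1 ∉ spectrum ℂ S := fun h => by
    have := hσ h
    simp [ht] at this
  rw [spectrum.notMem_iff] at h1
  have h2 : 1 - t • (S - 1) = t • (algebraMap ℂ A (t⁻¹ + 1) - S) := by
    rw [Algebra.algebraMap_eq_smul_one, smul_sub, smul_sub, smul_smul t (t⁻¹ + 1), mul_add,
      mul_inv_cancel₀ ht, mul_one, add_smul, one_smul]
    abel
  rw [h2]
  exact (h1.smul (Units.mk0 t ht) :)

variable [CompleteSpace A]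

/-- An element of a Banach algebra that is an invertible isometry with spectrum in `{1}` differs
from `1` by an element of square zero. -/
theorem sub_one_sq_eq_zero (S : Aˣ) (hS : ‖(S : A)‖ ≤ 1) (hS' : ‖((S⁻¹ : Aˣ) : A)‖ ≤ 1)
    (hσ : spectrum ℂ (S : A) ⊆ {1}) : ((S : A) - 1) ^ 2 = 0 := by
  set Q : A := (S : A) - 1 with hQ
  have hone := norm_one_le_of_unit S hS hS'
  have hu := isUnit_one_sub_smul (S : A) hσ
  rw [← hQ] at hu
  set F : ℂ → A := fun t => Ring.inverse (1 - t • Q) with hF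
  have hFmul : ∀ t, (1 - t • Q) * F t = 1 := fun t => Ring.mul_inverse_cancel _ (hu t)
  have hF0 : F 0 = 1 := by simp [hF]
  have hFd : Differentiable ℂ F := fun t =>
    (differentiableAt_inverse (𝕜 := ℂ) (hu t)).comp t
      ((differentiableAt_id.smul_const Q).const_sub 1)
  have hFeq : ∀ t, F t = 1 + t • (Q * F t) := fun t => by
    have := hFmul t
    rw [sub_mul, one_mul, smul_mul_assoc] at this
    rw [← this]
    abel
  -- The second-order Taylor remainder of `F`: on |t| = R it gains the factor R⁻² for Q² F.
  have hFsq : ∀ t, t ^ 2 • (Q ^ 2 * F t) = F t - 1 - t • Q := fun t => by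
    have h : F t = 1 + t • (Q * (1 + t • (Q * F t))) := by
      rw [← hFeq]
      exact hFeq t
    nth_rewrite 2 [h]
    rw [mul_add, mul_one, mul_smul_comm, smul_add, smul_smul, ← mul_assoc, ← pow_two, ← pow_two]
    abel
  have hFn : ∀ t, |‖t + 1‖ - ‖t‖| * ‖F t‖ ≤ 1 := fun t => by
    refine (abs_norm_sub_norm_mul_le S hS hS' (t + 1) t (F t)).trans ?_
    have : (t + 1) • F t - t • ((S : A) * F t) = 1 := by
      rw [← hFmul t, hQ, sub_mul, one_mul, smul_mul_assoc, sub_mul, one_mul, add_smul, one_smul,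
        smul_sub]
      abel
    rw [this]
    exact hone
  have key : ∀ R : ℝ, 1 ≤ R → ‖Q ^ 2‖ ≤ (6 + 3 * ‖Q‖) / R := by
    intro R hR
    have hR0 : 0 < R := by linarith
    -- The bound `hFn` degenerates where the circle meets |t + 1| = |t|. The factor `p` vanishes
    -- there and satisfies p(0) = 1, so p Q² F equals Q² at 0 and is O(1 / R) on the circle; the
    -- maximum principle applies.
    set p : ℂ → ℂ := fun t => 1 + (t + t ^ 2) / (R : ℂ) ^ 2 with hp
    have hd : Differentiable ℂ (fun t => p t • (Q ^ 2 * F t)) := by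
      have hpd : Differentiable ℂ p := by
        simp only [hp]
        fun_prop
      exact hpd.smul (hFd.const_mul (Q ^ 2))
    have hmax := Complex.norm_le_of_forall_mem_frontier_norm_le (U := Metric.ball (0 : ℂ) R)
      (C := (6 + 3 * ‖Q‖) / R) Metric.isBounded_ball hd.diffContOnCl ?_ (z := 0)
      (subset_closure (Metric.mem_ball_self hR0))
    · simpa [hp, hF0] using hmax
    intro t ht
    rw [frontier_ball _ hR0.ne', mem_sphere_zero_iff_norm] at ht
    have h1 := norm_one_add_div_sq_le hR ht
    have h2 : |‖t + 1‖ - ‖t‖| ≤ 1 := by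
      have := abs_norm_sub_norm_le (t + 1) t
      rwa [add_sub_cancel_left, norm_one] at this
    have h3 : ‖p t‖ ≤ 3 := by
      simp only [hp]
      linarith
    have h4 : ‖p t‖ * ‖F t‖ ≤ 3 := by
      calc ‖p t‖ * ‖F t‖ ≤ 3 * |‖t + 1‖ - ‖t‖| * ‖F t‖ :=
            mul_le_mul_of_nonneg_right h1 (norm_nonneg _)
        _ ≤ 3 := by linarith [hFn t]
    have h5 : R ^ 2 * ‖p t • (Q ^ 2 * F t)‖ = ‖p t‖ * ‖F t - 1 - t • Q‖ := by
      rw [← hFsq t, norm_smul, norm_smul, norm_pow, ht]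
      ring
    have h6 : ‖F t - 1 - t • Q‖ ≤ ‖F t‖ + 1 + R * ‖Q‖ := by
      refine (norm_sub_le _ _).trans (add_le_add ((norm_sub_le _ _).trans ?_) ?_)
      · linarith
      · rw [norm_smul, ht]
    have h7 : R ^ 2 * ‖p t • (Q ^ 2 * F t)‖ ≤ 3 + 3 + 3 * (R * ‖Q‖) := by
      rw [h5]
      calc _ ≤ ‖p t‖ * (‖F t‖ + 1 + R * ‖Q‖) := mul_le_mul_of_nonneg_left h6 (norm_nonneg _)
        _ = ‖p t‖ * ‖F t‖ + ‖p t‖ * 1 + ‖p t‖ * (R * ‖Q‖) := by ring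
        _ ≤ 3 + 3 + 3 * (R * ‖Q‖) := by
          have : ‖p t‖ * (R * ‖Q‖) ≤ 3 * (R * ‖Q‖) := mul_le_mul_of_nonneg_right h3 (by positivity)
          linarith
    have h8 : R ^ 2 * ‖p t • (Q ^ 2 * F t)‖ ≤ R * (6 + 3 * ‖Q‖) := by nlinarith
    rw [le_div_iff₀ hR0]
    have h9 : R * (‖p t • (Q ^ 2 * F t)‖ * R) ≤ R * (6 + 3 * ‖Q‖) := by linarith
    exact le_of_mul_le_mul_left h9 hR0
  exact norm_le_zero_iff.1 (nonpos_of_forall_le_div key)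

/-- Gelfand's theorem: an invertible isometry in a Banach algebra with spectrum in `{1}` is `1`. -/
theorem eq_one_of_spectrum_subset (S : Aˣ) (hS : ‖(S : A)‖ ≤ 1)
    (hS' : ‖((S⁻¹ : Aˣ) : A)‖ ≤ 1) (hσ : spectrum ℂ (S : A) ⊆ {1}) : (S : A) = 1 := by
  have hsq := sub_one_sq_eq_zero S hS hS' hσ
  have hone := norm_one_le_of_unit S hS hS'
  set Q : A := (S : A) - 1 with hQ
  have hSQ : (S : A) = 1 + Q := by rw [hQ]; abel
  -- Because Q² = 0, the powers of `S` grow linearly unless Q = 0, but they are contractions.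
  have hpow : ∀ n : ℕ, (S : A) ^ n = 1 + (n : ℂ) • Q := by
    intro n
    induction n with
    | zero => simp
    | succ n ih =>
      rw [pow_succ, ih, hSQ, mul_add, mul_one, add_mul, one_mul, smul_mul_assoc, ← pow_two, hsq,
        smul_zero]
      push_cast
      rw [add_smul, one_smul]
      abel
  have hpn : ∀ n : ℕ, ‖(S : A) ^ n‖ ≤ 1 := by
    intro n
    induction n with
    | zero => simpa using hone
    | succ n ih =>
      rw [pow_succ]
      exact (norm_mul_le _ _).trans (mul_le_one₀ ih (norm_nonneg _) hS)
  have key : ∀ R : ℝ, 1 ≤ R → ‖Q‖ ≤ 4 / R := by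
    intro R hR
    set n := ⌈R⌉₊
    have h1 : (n : ℂ) • Q = (S : A) ^ n - 1 := by rw [hpow]; abel
    have h2 : (n : ℝ) * ‖Q‖ ≤ 2 := by
      have := congrArg norm h1
      rw [norm_smul, Complex.norm_natCast] at this
      rw [this]
      exact (norm_sub_le _ _).trans (by linarith [hpn n])
    have h3 : R ≤ n := Nat.le_ceil R
    rw [le_div_iff₀ (by linarith)]
    nlinarith [norm_nonneg Q]
  have : Q = 0 := norm_le_zero_iff.1 (nonpos_of_forall_le_div key)
  rw [hSQ, this, add_zero]

end Gelfand

/-! ### Chebyshev polynomials outside `[-1, 1]` -/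

/-- Of the two exponentials in the cosine, one has modulus exp |Im w| and the other at most 1. -/
theorem Complex.norm_cos_ge (w : ℂ) : (Real.exp |w.im| - 1) / 2 ≤ ‖Complex.cos w‖ := by
  have h0 : Complex.cos w = (Complex.exp (w * I) + Complex.exp (-w * I)) / 2 := rfl
  have ha : ‖Complex.exp (w * I)‖ = Real.exp (-w.im) := by
    rw [Complex.norm_exp]; simp
  have hb : ‖Complex.exp (-w * I)‖ = Real.exp w.im := by
    rw [Complex.norm_exp]; simp
  have h1 := norm_sub_le_norm_add (Complex.exp (w * I)) (Complex.exp (-w * I))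
  have h2 := norm_sub_le_norm_add (Complex.exp (-w * I)) (Complex.exp (w * I))
  rw [add_comm (Complex.exp (-w * I))] at h2
  rw [ha, hb] at h1 h2
  rw [h0, norm_div, Complex.norm_ofNat]
  rcases le_total 0 w.im with h | h
  · rw [abs_of_nonneg h]
    have : Real.exp (-w.im) ≤ 1 := Real.exp_le_one_iff.2 (by linarith)
    linarith
  · rw [abs_of_nonpos h]
    have : Real.exp w.im ≤ 1 := Real.exp_le_one_iff.2 h
    linarith

/-- If the Chebyshev polynomials grow at most polynomially at `x`, then `x ∈ [-1, 1]`. -/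
theorem exists_real_of_chebyshev_bound {x : ℂ} {C : ℝ} {N : ℕ}
    (h : ∀ n : ℕ, ‖(Polynomial.Chebyshev.T ℂ n).eval x‖ ≤ C * (1 + (n : ℝ)) ^ N) :
    ∃ y : ℝ, y ∈ Set.Icc (-1) 1 ∧ x = (y : ℂ) := by
  obtain ⟨w, rfl⟩ := Complex.cos_surjective x
  by_cases hw : w.im = 0
  · refine ⟨Real.cos w.re, Real.cos_mem_Icc _, ?_⟩
    have : w = (w.re : ℂ) := Complex.ext (by simp) (by simp [hw])
    rw [Complex.ofReal_cos, ← this]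
  exfalso
  set ρ := Real.exp |w.im| with hρ
  have hρ1 : 1 < ρ := by rw [hρ]; exact Real.one_lt_exp_iff.2 (abs_pos.2 hw)
  have hb : ∀ n : ℕ, ρ ^ n ≤ 1 + 2 * C * (1 + (n : ℝ)) ^ N := by
    intro n
    have h1 := h n
    rw [Polynomial.Chebyshev.T_complex_cos] at h1
    have h2 := Complex.norm_cos_ge (((n : ℤ) : ℂ) * w)
    have h3 : (((n : ℤ) : ℂ) * w).im = n * w.im := by simp
    rw [h3, abs_mul, abs_of_nonneg (Nat.cast_nonneg n), Real.exp_nat_mul] at h2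
    linarith
  -- The bound `hb` divided by ρ ^ n. The index is moved to n + 1 so that (1 + n) ^ N is the power
  -- in the standard limit; the outer ρ compensates.
  have ht : Tendsto (fun n : ℕ => ρ * (1 / ρ ^ (n + 1)
      + 2 * C * (((n + 1 : ℕ) : ℝ) ^ N / ρ ^ (n + 1)))) atTop (𝓝 (ρ * (0 + 2 * C * 0))) := by
    have h1 := (tendsto_add_atTop_iff_nat 1).2 (tendsto_pow_const_div_const_pow_of_one_lt 0 hρ1)
    have h2 := (tendsto_add_atTop_iff_nat 1).2 (tendsto_pow_const_div_const_pow_of_one_lt N hρ1)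
    simp only [pow_zero] at h1
    exact (h1.add (h2.const_mul _)).const_mul _
  have h1 : (1 : ℝ) ≤ ρ * (0 + 2 * C * 0) := by
    refine ge_of_tendsto ht (Eventually.of_forall fun n => ?_)
    have h2 := hb n
    have hpos : 0 < ρ ^ n := by positivity
    have h3 : ρ * (1 / ρ ^ (n + 1) + 2 * C * (((n + 1 : ℕ) : ℝ) ^ N / ρ ^ (n + 1)))
        = (1 + 2 * C * (1 + (n : ℝ)) ^ N) / ρ ^ n := by
      push_cast
      rw [pow_succ]
      field_simp
      ring
    rw [h3, le_div_iff₀ hpos, one_mul]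
    exact h2
  norm_num at h1

/-- The spectrum of an invertible isometry `S` for which `x = (1 - r S) / b` has Chebyshev
polynomials of polynomial growth. -/
theorem spectrum_of_chebyshev_bound {A : Type*} [NormedRing A] [NormedAlgebra ℂ A]
    [CompleteSpace A] (S : Aˣ) (hS : ‖(S : A)‖ ≤ 1) (hS' : ‖((S⁻¹ : Aˣ) : A)‖ ≤ 1) {b r : ℝ}
    (hb0 : 0 < b) (hb1 : b < 1) (hr : 0 < r) {C : ℝ} {N : ℕ} (X : A)
    (hX : X = (1 / b : ℂ) • 1 - ((r : ℂ) / b) • (S : A))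
    (h : ∀ n : ℕ, ‖Polynomial.aeval X (Polynomial.Chebyshev.T ℂ n)‖ ≤ C * (1 + (n : ℝ)) ^ N)
    {z : ℂ} (hz : z ∈ spectrum ℂ (S : A)) : z = 1 ∧ r ∈ Set.Icc (1 - b) (1 + b) := by
  have hone := norm_one_le_of_unit S hS hS'
  have hz1 : ‖z‖ ≤ 1 := (spectrum.norm_le_norm_mul_of_mem hz).trans
    (mul_le_one₀ hS (norm_nonneg _) hone)
  have hz0 : z ≠ 0 := spectrum.ne_zero_of_mem_of_unit hz
  have hz2 : ‖z‖⁻¹ ≤ 1 := by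
    rw [← norm_inv]
    have : z⁻¹ ∈ spectrum ℂ ((S⁻¹ : Aˣ) : A) := spectrum.inv₀_mem_inv_iff.2 hz
    exact (spectrum.norm_le_norm_mul_of_mem this).trans (mul_le_one₀ hS' (norm_nonneg _) hone)
  have hz3 : ‖z‖ = 1 := by
    refine le_antisymm hz1 ?_
    have : 0 < ‖z‖ := norm_pos_iff.2 hz0
    rwa [inv_le_one₀ this] at hz2
  set x : ℂ := 1 / b - r / b * z with hx
  have hxX : x ∈ spectrum ℂ X := by
    have := spectrum.subset_polynomial_aeval (S : A)
      (Polynomial.C (1 / (b : ℂ)) - Polynomial.C ((r : ℂ) / b) * Polynomial.X) ⟨z, hz, rfl⟩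
    simpa [hX, hx, Algebra.smul_def] using this
  obtain ⟨y, ⟨hy1, hy2⟩, hy⟩ := exists_real_of_chebyshev_bound (x := x) (C := C) (N := N) (by
    intro n
    have := spectrum.subset_polynomial_aeval X (Polynomial.Chebyshev.T ℂ n) ⟨x, hxX, rfl⟩
    refine (spectrum.norm_le_norm_mul_of_mem this).trans ?_
    exact (mul_le_of_le_one_right (norm_nonneg _) hone).trans (h n))
  have hbC : (b : ℂ) ≠ 0 := by exact_mod_cast hb0.ne'
  have hrC : (r : ℂ) ≠ 0 := by exact_mod_cast hr.ne'
  have hrz : (r : ℂ) * z = ((1 - b * y : ℝ) : ℂ) := by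
    have : (b : ℂ) * x = 1 - r * z := by rw [hx]; field_simp
    rw [hy] at this
    push_cast
    linear_combination this
  -- Here b < 1 enters: r z is positive, so it equals its modulus r.
  have hpos : 0 < 1 - b * y := by nlinarith
  have hreq : r = 1 - b * y := by
    have := congrArg norm hrz
    rwa [norm_mul, hz3, mul_one, Complex.norm_real, Complex.norm_real, Real.norm_eq_abs,
      Real.norm_eq_abs, abs_of_pos hr, abs_of_pos hpos] at this
  refine ⟨?_, ?_, ?_⟩
  · rw [← hreq] at hrz
    exact mul_left_cancel₀ hrC (by rw [hrz, mul_one])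
  · nlinarith
  · nlinarith

/-- An invertible isometry `S` of a Banach space for which `(1 - r S) / b` has Chebyshev
polynomials of polynomial growth is the identity; the space is trivial unless `r` lies in
`[1 - b, 1 + b]`. -/
theorem isometry_rigidity {E : Type*} [NormedAddCommGroup E] [NormedSpace ℂ E] [CompleteSpace E]
    (S : (E →L[ℂ] E)ˣ) (hS : ‖(S : E →L[ℂ] E)‖ ≤ 1)
    (hS' : ‖((S⁻¹ : (E →L[ℂ] E)ˣ) : E →L[ℂ] E)‖ ≤ 1) {b r : ℝ}
    (hb0 : 0 < b) (hb1 : b < 1) (hr : 0 < r) {C : ℝ} {N : ℕ} (X : E →L[ℂ] E)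
    (hX : X = (1 / b : ℂ) • 1 - ((r : ℂ) / b) • (S : E →L[ℂ] E))
    (h : ∀ n : ℕ, ‖Polynomial.aeval X (Polynomial.Chebyshev.T ℂ n)‖ ≤ C * (1 + (n : ℝ)) ^ N) :
    (S : E →L[ℂ] E) = 1 ∧ (r ∉ Set.Icc (1 - b) (1 + b) → Subsingleton E) := by
  refine ⟨eq_one_of_spectrum_subset S hS hS' fun z hz =>
    (spectrum_of_chebyshev_bound S hS hS' hb0 hb1 hr X hX h hz).1, fun hrn => ?_⟩
  by_contra hE
  have : Nontrivial E := not_subsingleton_iff_nontrivial.1 hE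
  -- A nontrivial space would give a spectral point, and any such point puts `r` in the interval.
  obtain ⟨z, hz⟩ := spectrum.nonempty (S : E →L[ℂ] E)
  exact hrn (spectrum_of_chebyshev_bound S hS hS' hb0 hb1 hr X hX h hz).2

noncomputable section

namespace HomogeneousTree

/-! ### Doubly indexed sequences with a three-term recurrence -/

/-- The weight `(1 + |n|) ^ N` on `ℤ`. -/
def growthWeight (N : ℕ) (n : ℤ) : ℝ := (1 + |(n : ℝ)|) ^ N

theorem growthWeight_pos (N : ℕ) (n : ℤ) : 0 < growthWeight N n := by
  unfold growthWeight
  positivity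

/-- Submultiplicativity of the weight: translating by `m` in the second index costs at most the
weight of `m`. -/
theorem growthWeight_add_le (N : ℕ) (m n : ℤ) :
    growthWeight N (m + n) ≤ growthWeight N n * growthWeight N m := by
  unfold growthWeight
  rw [← mul_pow]
  refine pow_le_pow_left₀ (by positivity) ?_ N
  push_cast
  nlinarith [abs_add_le (m : ℝ) n, abs_nonneg (m : ℝ), abs_nonneg (n : ℝ),
    mul_nonneg (abs_nonneg (m : ℝ)) (abs_nonneg (n : ℝ))]

theorem growthWeight_neg (N : ℕ) (n : ℤ) : growthWeight N (-n) = growthWeight N n := by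
  simp [growthWeight]

open BoundedContinuousFunction

/-- Evaluation of the sequence with normalization `u`. -/
def growthEval (N : ℕ) (k n : ℤ) : ((ℤ × ℤ) →ᵇ ℂ) →L[ℂ] ℂ :=
  (growthWeight N n : ℂ) • BoundedContinuousFunction.evalCLM ℂ (k, n)

theorem growthEval_apply (N : ℕ) (k n : ℤ) (u : (ℤ × ℤ) →ᵇ ℂ) :
    growthEval N k n u = growthWeight N n * u (k, n) := rfl

theorem norm_growthEval_le (N : ℕ) (k n : ℤ) (u : (ℤ × ℤ) →ᵇ ℂ) :
    ‖growthEval N k n u‖ ≤ growthWeight N n * ‖u‖ := by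
  rw [growthEval_apply, norm_mul, Complex.norm_real, Real.norm_eq_abs,
    abs_of_pos (growthWeight_pos N n)]
  exact mul_le_mul_of_nonneg_left (u.norm_coe_le_norm _) (growthWeight_pos N n).le

theorem norm_le_of_growthEval (N : ℕ) {u : (ℤ × ℤ) →ᵇ ℂ} {B : ℝ} (hB : 0 ≤ B)
    (h : ∀ k n, ‖growthEval N k n u‖ ≤ growthWeight N n * B) : ‖u‖ ≤ B := by
  refine (BoundedContinuousFunction.norm_le hB).2 fun x => ?_
  have := h x.1 x.2
  rw [growthEval_apply, norm_mul, Complex.norm_real, Real.norm_eq_abs,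
    abs_of_pos (growthWeight_pos N x.2)] at this
  exact le_of_mul_le_mul_left this (growthWeight_pos N x.2)

/-- The Banach space of the sequences `v k n` of growth at most `(1 + |n|) ^ N` such that
`v k (n + 1) + v k (n - 1) = (2 / b) (v k n - r v (k + 1) n)`. -/
def recurrenceSpace (N : ℕ) (b r : ℝ) : Submodule ℂ ((ℤ × ℤ) →ᵇ ℂ) :=
  ⨅ (k : ℤ) (n : ℤ), LinearMap.ker (growthEval N k (n + 1) + growthEval N k (n - 1)
    - (2 / b : ℂ) • (growthEval N k n - (r : ℂ) • growthEval N (k + 1) n)).toLinearMap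

theorem mem_recurrenceSpace {N : ℕ} {b r : ℝ} {u : (ℤ × ℤ) →ᵇ ℂ} :
    u ∈ recurrenceSpace N b r ↔ ∀ k n, growthEval N k (n + 1) u + growthEval N k (n - 1) u
      = (2 / b : ℂ) * (growthEval N k n u - r * growthEval N (k + 1) n u) := by
  simp [recurrenceSpace, Submodule.mem_iInf, sub_eq_zero]

theorem isClosed_recurrenceSpace (N : ℕ) (b r : ℝ) :
    IsClosed (recurrenceSpace N b r : Set ((ℤ × ℤ) →ᵇ ℂ)) := by
  simp only [recurrenceSpace, Submodule.coe_iInf]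
  refine isClosed_iInter fun k => isClosed_iInter fun n => ?_
  exact ContinuousLinearMap.isClosed_ker (growthEval N k (n + 1) + growthEval N k (n - 1)
    - (2 / b : ℂ) • (growthEval N k n - (r : ℂ) • growthEval N (k + 1) n))

instance (N : ℕ) (b r : ℝ) : CompleteSpace (recurrenceSpace N b r) :=
  (isClosed_recurrenceSpace N b r).completeSpace_coe

/-- The shift `v k n ↦ v (k + j) n`. -/
def recurrenceShift (N : ℕ) (b r : ℝ) (j : ℤ) :
    recurrenceSpace N b r →L[ℂ] recurrenceSpace N b r :=
  LinearMap.mkContinuous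
    { toFun := fun u => ⟨u.1.compContinuous ⟨fun x => (x.1 + j, x.2), continuous_of_discreteTopology⟩,
        mem_recurrenceSpace.2 fun k n => by
          have := mem_recurrenceSpace.1 u.2 (k + j) n
          rw [add_right_comm] at this
          exact this⟩
      map_add' := fun u v => rfl
      map_smul' := fun c u => rfl } 1 (fun u => by
        rw [one_mul]
        exact (BoundedContinuousFunction.norm_le (norm_nonneg _)).2
          fun x => u.1.norm_coe_le_norm _)

variable {N : ℕ} {b r : ℝ}

theorem growthEval_recurrenceShift (j k n : ℤ) (u : recurrenceSpace N b r) :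
    growthEval N k n (recurrenceShift N b r j u : (ℤ × ℤ) →ᵇ ℂ) = growthEval N (k + j) n u := rfl

theorem norm_recurrenceShift_le (j : ℤ) : ‖recurrenceShift N b r j‖ ≤ 1 :=
  LinearMap.mkContinuous_norm_le _ zero_le_one _

theorem recurrenceSpace_ext {u v : recurrenceSpace N b r}
    (h : ∀ k n, growthEval N k n (u : (ℤ × ℤ) →ᵇ ℂ) = growthEval N k n v) : u = v := by
  refine Subtype.ext (BoundedContinuousFunction.ext fun x => ?_)
  have h1 := h x.1 x.2
  rw [growthEval_apply, growthEval_apply] at h1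
  exact mul_left_cancel₀ (by exact_mod_cast (growthWeight_pos N x.2).ne') h1

variable (N b r) in
/-- The shift `v k n ↦ v (k + 1) n` as a unit. -/
def recurrenceShiftUnit : (recurrenceSpace N b r →L[ℂ] recurrenceSpace N b r)ˣ where
  val := recurrenceShift N b r 1
  inv := recurrenceShift N b r (-1)
  val_inv := by
    refine ContinuousLinearMap.ext fun u => recurrenceSpace_ext fun k n => ?_
    change growthEval N (k + 1 + -1) n (u : (ℤ × ℤ) →ᵇ ℂ) = growthEval N k n u
    rw [add_neg_cancel_right]
  inv_val := by
    refine ContinuousLinearMap.ext fun u => recurrenceSpace_ext fun k n => ?_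
    change growthEval N (k + -1 + 1) n (u : (ℤ × ℤ) →ᵇ ℂ) = growthEval N k n u
    rw [neg_add_cancel_right]

theorem norm_recurrenceShiftUnit_le :
    ‖(recurrenceShiftUnit N b r : recurrenceSpace N b r →L[ℂ] recurrenceSpace N b r)‖ ≤ 1 :=
  norm_recurrenceShift_le 1

theorem norm_recurrenceShiftUnit_inv_le :
    ‖(((recurrenceShiftUnit N b r)⁻¹ : (recurrenceSpace N b r →L[ℂ] recurrenceSpace N b r)ˣ) :
      recurrenceSpace N b r →L[ℂ] recurrenceSpace N b r)‖ ≤ 1 :=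
  norm_recurrenceShift_le (-1)

variable (N b r) in
/-- The average `(1 - r S) / b` of the two shifts in `n`, where `S` is the shift in `k`. -/
def recurrenceAverage : recurrenceSpace N b r →L[ℂ] recurrenceSpace N b r :=
  (1 / b : ℂ) • 1 - ((r : ℂ) / b) • recurrenceShift N b r 1

theorem two_mul_growthEval_recurrenceAverage (k n : ℤ) (u : recurrenceSpace N b r) :
    2 * growthEval N k n (recurrenceAverage N b r u : (ℤ × ℤ) →ᵇ ℂ)
      = growthEval N k (n + 1) (u : (ℤ × ℤ) →ᵇ ℂ) + growthEval N k (n - 1) u := by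
  have h1 : (recurrenceAverage N b r u : (ℤ × ℤ) →ᵇ ℂ) = (1 / b : ℂ) • (u : (ℤ × ℤ) →ᵇ ℂ)
      - ((r : ℂ) / b) • (recurrenceShift N b r 1 u : (ℤ × ℤ) →ᵇ ℂ) := by
    rfl
  rw [mem_recurrenceSpace.1 u.2 k n, h1, map_sub, map_smul, map_smul, growthEval_recurrenceShift,
    smul_eq_mul, smul_eq_mul]
  ring

/-- This is T_m((s + s⁻¹) / 2) = (s ^ m + s ^ (-m)) / 2 for the unit shift s in n, read off through
evaluations. -/
theorem two_mul_growthEval_chebyshev (m : ℕ) (u : recurrenceSpace N b r) (k n : ℤ) :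
    2 * growthEval N k n (Polynomial.aeval (recurrenceAverage N b r)
        (Polynomial.Chebyshev.T ℂ m) u : (ℤ × ℤ) →ᵇ ℂ)
      = growthEval N k (n + m) (u : (ℤ × ℤ) →ᵇ ℂ) + growthEval N k (n - m) u := by
  induction m using Nat.twoStepInduction generalizing n with
  | zero => simp [two_mul]
  | one => simpa using two_mul_growthEval_recurrenceAverage k n u
  | more m ih1 ih2 =>
    have h1 : Polynomial.aeval (recurrenceAverage N b r) (Polynomial.Chebyshev.T ℂ ((m + 2 : ℕ) : ℤ)) u
        = (2 : ℂ) • recurrenceAverage N b r (Polynomial.aeval (recurrenceAverage N b r)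
            (Polynomial.Chebyshev.T ℂ ((m + 1 : ℕ) : ℤ)) u)
          - Polynomial.aeval (recurrenceAverage N b r) (Polynomial.Chebyshev.T ℂ (m : ℤ)) u := by
      push_cast
      rw [Polynomial.Chebyshev.T_add_two, map_sub, map_mul, map_mul, Polynomial.aeval_X, map_ofNat,
        _root_.sub_apply, mul_assoc, two_smul, two_mul]
      rfl
    rw [h1, Submodule.coe_sub, Submodule.coe_smul, map_sub, map_smul, smul_eq_mul,
      two_mul_growthEval_recurrenceAverage, mul_sub, mul_add, ih1, ih2, ih2]
    have e1 : n + 1 + ((m + 1 : ℕ) : ℤ) = n + ((m + 2 : ℕ) : ℤ) := by push_cast; ring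
    have e2 : n + 1 - ((m + 1 : ℕ) : ℤ) = n - m := by push_cast; ring
    have e3 : n - 1 + ((m + 1 : ℕ) : ℤ) = n + m := by push_cast; ring
    have e4 : n - 1 - ((m + 1 : ℕ) : ℤ) = n - ((m + 2 : ℕ) : ℤ) := by push_cast; ring
    rw [e1, e2, e3, e4]
    ring

theorem norm_chebyshev_recurrenceAverage_le (m : ℕ) :
    ‖Polynomial.aeval (recurrenceAverage N b r) (Polynomial.Chebyshev.T ℂ m)‖
      ≤ 1 * (1 + (m : ℝ)) ^ N := by
  have hm : 1 * (1 + (m : ℝ)) ^ N = growthWeight N m := by simp [growthWeight]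
  rw [hm]
  refine ContinuousLinearMap.opNorm_le_bound _ (growthWeight_pos N m).le fun u => ?_
  change ‖((Polynomial.aeval (recurrenceAverage N b r) (Polynomial.Chebyshev.T ℂ m) u :
    recurrenceSpace N b r) : (ℤ × ℤ) →ᵇ ℂ)‖ ≤ _
  refine norm_le_of_growthEval N (mul_nonneg (growthWeight_pos N m).le (norm_nonneg _)) fun k n => ?_
  have h1 := congrArg norm (two_mul_growthEval_chebyshev m u k n)
  rw [norm_mul, Complex.norm_ofNat] at h1
  have h2 := norm_add_le (growthEval N k (n + m) (u : (ℤ × ℤ) →ᵇ ℂ)) (growthEval N k (n - m) u)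
  have h3 := norm_growthEval_le N k (n + m) (u : (ℤ × ℤ) →ᵇ ℂ)
  have h4 := norm_growthEval_le N k (n - m) (u : (ℤ × ℤ) →ᵇ ℂ)
  have h5 := mul_le_mul_of_nonneg_right (growthWeight_add_le N n m) (norm_nonneg u)
  have h6 := mul_le_mul_of_nonneg_right (growthWeight_add_le N n (-m)) (norm_nonneg u)
  rw [growthWeight_neg, ← sub_eq_add_neg] at h6
  have h7 : ‖u‖ = ‖(u : (ℤ × ℤ) →ᵇ ℂ)‖ := rfl
  rw [h7] at h5 h6 ⊢
  linarith

/-- A doubly indexed sequence of polynomial growth in `n`, uniformly in `k`, on which the shift in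
`k` acts as `r⁻¹ (1 - b / 2 (shift + shift⁻¹))` in `n`, does not depend on `k`; it vanishes unless
`r` lies in `[1 - b, 1 + b]`. -/
theorem recurrence_rigidity (hb0 : 0 < b) (hb1 : b < 1) (hr : 0 < r) {C : ℝ} {v : ℤ → ℤ → ℂ}
    (hv : ∀ k n, ‖v k n‖ ≤ C * (1 + |(n : ℝ)|) ^ N)
    (hrec : ∀ k n, v k (n + 1) + v k (n - 1) = (2 / b : ℂ) * (v k n - r * v (k + 1) n)) :
    (∀ k n, v (k + 1) n = v k n) ∧ (r ∉ Set.Icc (1 - b) (1 + b) → ∀ k n, v k n = 0) := by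
  have hw : ∀ n, (growthWeight N n : ℂ) ≠ 0 := fun n => by
    exact_mod_cast (growthWeight_pos N n).ne'
  let u₀ : (ℤ × ℤ) →ᵇ ℂ := BoundedContinuousFunction.ofNormedAddCommGroup
    (fun x => v x.1 x.2 / growthWeight N x.2) continuous_of_discreteTopology C (fun x => by
      rw [norm_div, Complex.norm_real, Real.norm_eq_abs, abs_of_pos (growthWeight_pos N x.2),
        div_le_iff₀ (growthWeight_pos N x.2)]
      exact hv x.1 x.2)
  have hu₀ : ∀ k n, growthEval N k n u₀ = v k n := fun k n => by
    rw [growthEval_apply]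
    exact mul_div_cancel₀ _ (hw n)
  let u : recurrenceSpace N b r := ⟨u₀, mem_recurrenceSpace.2 fun k n => by
    simp only [hu₀]
    exact hrec k n⟩
  obtain ⟨h1, h2⟩ := isometry_rigidity (recurrenceShiftUnit N b r) norm_recurrenceShiftUnit_le
    norm_recurrenceShiftUnit_inv_le hb0 hb1 hr (recurrenceAverage N b r) rfl
    norm_chebyshev_recurrenceAverage_le
  constructor
  · intro k n
    have h3 : growthEval N k n (recurrenceShift N b r 1 u : (ℤ × ℤ) →ᵇ ℂ)
        = growthEval N k n (u : (ℤ × ℤ) →ᵇ ℂ) :=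
      congrArg (fun S : recurrenceSpace N b r →L[ℂ] recurrenceSpace N b r =>
        growthEval N k n (S u : (ℤ × ℤ) →ᵇ ℂ)) h1
    rw [growthEval_recurrenceShift] at h3
    simpa only [u, hu₀] using h3
  · intro hrn k n
    have := h2 hrn
    have hu : u₀ = 0 := congrArg Subtype.val (Subsingleton.elim u 0)
    rw [← hu₀, hu, map_zero]

end HomogeneousTree

end

/-! ### Growth of the Chebyshev polynomials of the Laplacian on the tree -/

noncomputable section

namespace HomogeneousTree

variable {V : Type*} {G : SimpleGraph V} {q : ℕ}

variable (G q) in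
/-- The spherical function `(1 + (q - 1) / (q + 1) |x|) q ^ (-|x| / 2)`. -/
def sphericalFun (o x : V) : ℝ :=
  (1 + ((q : ℝ) - 1) / (q + 1) * G.dist o x) / Real.sqrt q ^ G.dist o x

theorem sphericalFun_le (o x : V) :
    sphericalFun G q o x ≤ (1 + G.dist o x) / Real.sqrt q ^ G.dist o x := by
  unfold sphericalFun
  refine div_le_div_of_nonneg_right ?_ (by positivity)
  have h : ((q : ℝ) - 1) / (q + 1) ≤ 1 := (div_le_one (by positivity)).2 (by linarith)
  nlinarith [Nat.cast_nonneg (α := ℝ) (G.dist o x)]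

variable [G.LocallyFinite]

/-! ### Chebyshev polynomials of the adjacency operator -/

section WalkSum

variable {R : Type*} [CommRing R]

variable (G) in
/-- The adjacency operator. -/
def adjSum (f : V → R) (x : V) : R := ∑ y ∈ G.neighborFinset x, f y

variable (G q) in
/-- The operators `q ^ (n / 2) U_n (A / (2 √q))`, where `A` is the adjacency operator and `U_n` is
the Chebyshev polynomial of the second kind. -/
def walkSum (f : V → R) : ℕ → V → R
  | 0 => f
  | 1 => adjSum G f
  | n + 2 => fun x => adjSum G (walkSum f (n + 1)) x - q * walkSum f n x

theorem adjSum_const_mul (c : R) (f : V → R) (x : V) :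
    adjSum G (fun y => c * f y) x = c * adjSum G f x := (Finset.mul_sum _ _ _).symm

open Classical in
theorem walkSum_one_sub (f : V → R) {x p : V} (hp : G.Adj x p) :
    walkSum G q f 1 x - walkSum G q f 0 p = ∑ y ∈ (G.neighborFinset x).erase p, f y := by
  have hp' : p ∈ G.neighborFinset x := by simpa using hp
  simp only [walkSum, adjSum]
  rw [← Finset.sum_erase_add _ _ hp', add_sub_cancel_right]

-- Since `x` has exactly `q` neighbours besides `p`, the subtracted term q W_n(x) spreads evenly
-- over them. Differences along an edge thus become sums of differences one level lower, without
-- minus signs; this is the source of positivity.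
open Classical in
theorem walkSum_add_two_sub (hG : IsHomogeneousTree G q) (f : V → R) (n : ℕ) {x p : V}
    (hp : G.Adj x p) :
    walkSum G q f (n + 2) x - walkSum G q f (n + 1) p
      = ∑ y ∈ (G.neighborFinset x).erase p, (walkSum G q f (n + 1) y - walkSum G q f n x) := by
  have hp' : p ∈ G.neighborFinset x := by simpa using hp
  have hcard : ((G.neighborFinset x).erase p).card = q := by
    rw [Finset.card_erase_of_mem hp', SimpleGraph.card_neighborFinset_eq_degree, hG.regular x,
      Nat.add_sub_cancel]
  rw [Finset.sum_sub_distrib, Finset.sum_const, hcard, nsmul_eq_mul]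
  simp only [walkSum, adjSum]
  rw [← Finset.sum_erase_add _ _ hp']
  ring

end WalkSum

theorem exists_adj (hG : IsHomogeneousTree G q) (x : V) : ∃ p, G.Adj x p := by
  have h : 0 < (G.neighborFinset x).card := by
    rw [SimpleGraph.card_neighborFinset_eq_degree, hG.regular x]
    exact q.succ_pos
  obtain ⟨p, hp⟩ := Finset.card_pos.1 h
  exact ⟨p, by simpa using hp⟩

theorem dist_le_succ_of_adj (hG : IsHomogeneousTree G q) {x y z : V} {n : ℕ} (h : G.Adj x y)
    (hz : G.dist y z ≤ n) : G.dist x z ≤ n + 1 := by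
  have h1 := hG.isTree.connected.dist_triangle (u := x) (v := y) (w := z)
  rw [SimpleGraph.dist_eq_one_iff_adj.2 h] at h1
  omega

/-- The operators `walkSum` have nonnegative kernels, supported within distance `n`. -/
theorem norm_walkSum_le_aux (hG : IsHomogeneousTree G q) {φ : V → ℂ} {h : V → ℝ} (n : ℕ) :
    (∀ x, (∀ y, G.dist x y ≤ n → ‖φ y‖ ≤ h y) →
      ‖walkSum G q φ n x‖ ≤ walkSum G q h n x) ∧
    ∀ x p, G.Adj x p → (∀ y, G.dist x y ≤ n + 1 → ‖φ y‖ ≤ h y) →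
      ‖walkSum G q φ (n + 1) x - walkSum G q φ n p‖
        ≤ walkSum G q h (n + 1) x - walkSum G q h n p := by
  classical
  -- Neither clause closes alone: the value at level n + 1 is an edge difference plus a value at
  -- level n, and edge differences reduce to edge differences.
  induction n with
  | zero =>
    refine ⟨fun x hx => hx x (by simp), fun x p hp hx => ?_⟩
    rw [walkSum_one_sub _ hp, walkSum_one_sub _ hp]
    refine (norm_sum_le _ _).trans (Finset.sum_le_sum fun y hy => hx y ?_)
    have hxy : G.Adj x y := by simpa using Finset.mem_of_mem_erase hy
    exact (SimpleGraph.dist_eq_one_iff_adj.2 hxy).le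
  | succ n ih =>
    refine ⟨fun x hx => ?_, fun x p hp hx => ?_⟩
    · obtain ⟨p, hp⟩ := exists_adj hG x
      have h1 := ih.2 x p hp hx
      have h2 := ih.1 p fun y hy => hx y (dist_le_succ_of_adj hG hp hy)
      have h3 := norm_add_le (walkSum G q φ (n + 1) x - walkSum G q φ n p) (walkSum G q φ n p)
      rw [sub_add_cancel] at h3
      linarith
    · rw [walkSum_add_two_sub hG _ _ hp, walkSum_add_two_sub hG _ _ hp]
      refine (norm_sum_le _ _).trans (Finset.sum_le_sum fun y hy => ?_)
      have hxy : G.Adj x y := by simpa using Finset.mem_of_mem_erase hy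
      exact ih.2 y x hxy.symm fun z hz => hx z (dist_le_succ_of_adj hG hxy hz)

theorem norm_walkSum_le (hG : IsHomogeneousTree G q) {φ : V → ℂ} {h : V → ℝ} (n : ℕ) (x : V)
    (hx : ∀ y, G.dist x y ≤ n → ‖φ y‖ ≤ h y) : ‖walkSum G q φ n x‖ ≤ walkSum G q h n x :=
  (norm_walkSum_le_aux hG n).1 x hx

/-! ### The spherical function -/

/-- Two neighbours of `x` closer to `o` would begin two geodesics from `x` to `o`, but paths in an
acyclic graph are unique. -/
theorem exists_unique_parent (hG : IsHomogeneousTree G q) {o x : V} (hx : x ≠ o) :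
    ∃ p, G.Adj x p ∧ G.dist o x = G.dist o p + 1 ∧
      ∀ y, G.Adj x y → y ≠ p → G.dist o y = G.dist o x + 1 := by
  have hc := hG.isTree.connected
  have hor : ∀ y, G.Adj x y → G.dist o x = G.dist o y + 1 ∨ G.dist o y = G.dist o x + 1 :=
    fun y hy => hG.isTree.isAcyclic.dist_eq_dist_add_one_of_adj_of_reachable o hy (hc o x)
  have hpath : ∀ y, G.Adj x y → G.dist o x = G.dist o y + 1 →
      ∃ w : G.Walk x o, w.IsPath ∧ w.snd = y := by
    intro y hy hd
    obtain ⟨w, hw⟩ := hc.exists_walk_length_eq_dist y o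
    refine ⟨w.cons hy, ?_, SimpleGraph.Walk.snd_cons _ _⟩
    refine SimpleGraph.Walk.isPath_of_length_eq_dist _ ?_
    rw [SimpleGraph.Walk.length_cons, hw, SimpleGraph.dist_comm, ← hd, SimpleGraph.dist_comm]
  obtain ⟨w, hw⟩ := hc.exists_walk_length_eq_dist x o
  cases w with
  | nil => exact absurd rfl hx
  | @cons _ p _ hp w' =>
    have h1 := SimpleGraph.dist_le w'
    rw [SimpleGraph.Walk.length_cons] at hw
    have h2 : G.dist o x = G.dist o p + 1 := by
      rw [SimpleGraph.dist_comm (u := p)] at h1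
      rw [SimpleGraph.dist_comm (u := x)] at hw
      rcases hor p hp with h | h <;> omega
    refine ⟨p, hp, h2, fun y hy hyp => (hor y hy).resolve_left fun hd => hyp ?_⟩
    obtain ⟨w₁, hw₁, rfl⟩ := hpath y hy hd
    obtain ⟨w₂, hw₂, rfl⟩ := hpath p hp h2
    have := congrArg Subtype.val ((hG.isTree.isAcyclic.subsingleton_path x o).elim
      (⟨w₁, hw₁⟩ : G.Path x o) ⟨w₂, hw₂⟩)
    simp only at this
    rw [this]

/-- The adjacency operator on radial functions. -/
theorem adjSum_radial (hG : IsHomogeneousTree G q) {o x : V} (hx : x ≠ o) (g : ℕ → ℝ) :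
    adjSum G (fun y => g (G.dist o y)) x
      = q * g (G.dist o x + 1) + g (G.dist o x - 1) := by
  classical
  obtain ⟨p, hp, hd, hy⟩ := exists_unique_parent hG hx
  have hp' : p ∈ G.neighborFinset x := by simpa using hp
  have hcard : ((G.neighborFinset x).erase p).card = q := by
    rw [Finset.card_erase_of_mem hp', SimpleGraph.card_neighborFinset_eq_degree, hG.regular x,
      Nat.add_sub_cancel]
  rw [adjSum, ← Finset.sum_erase_add _ _ hp', hd, Nat.add_sub_cancel, ← hd]
  congr 1
  rw [Finset.sum_congr rfl (g := fun _ => g (G.dist o x + 1)) fun y hmem => ?_, Finset.sum_const,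
    hcard, nsmul_eq_mul]
  have hxy : G.Adj x y := by simpa using Finset.mem_of_mem_erase hmem
  rw [hy y hxy (Finset.ne_of_mem_erase hmem)]

theorem adjSum_radial_self (hG : IsHomogeneousTree G q) (o : V) (g : ℕ → ℝ) :
    adjSum G (fun y => g (G.dist o y)) o = (q + 1) * g 1 := by
  rw [adjSum, Finset.sum_congr rfl (g := fun _ => g 1) fun y hmem => ?_, Finset.sum_const,
    SimpleGraph.card_neighborFinset_eq_degree, hG.regular o, nsmul_eq_mul]
  · push_cast
    rfl
  · have hxy : G.Adj o y := by simpa using hmem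
    rw [SimpleGraph.dist_eq_one_iff_adj.2 hxy]

theorem sqrt_pos (hG : IsHomogeneousTree G q) : 0 < Real.sqrt q :=
  Real.sqrt_pos.2 (by exact_mod_cast lt_of_lt_of_le two_pos hG.two_le)

/-- At the eigenvalue 2 √q the radial recurrence has a double root, hence the factor linear in the
distance; the equation at `o` fixes its slope (q - 1) / (q + 1). -/
theorem adjSum_sphericalFun (hG : IsHomogeneousTree G q) (o x : V) :
    adjSum G (sphericalFun G q o) x = 2 * Real.sqrt q * sphericalFun G q o x := by
  have hs := sqrt_pos hG
  have hsq : Real.sqrt q ^ 2 = q := Real.sq_sqrt (Nat.cast_nonneg q)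
  set s := Real.sqrt q with hsdef
  have hq1 : (q : ℝ) + 1 ≠ 0 := by positivity
  set g : ℕ → ℝ := fun d => (1 + ((q : ℝ) - 1) / (q + 1) * d) / s ^ d with hg
  have hgs : sphericalFun G q o = fun y => g (G.dist o y) := rfl
  rw [hgs]
  by_cases hx : x = o
  · rw [hx, adjSum_radial_self hG]
    simp only [hg, SimpleGraph.dist_self, Nat.cast_one, Nat.cast_zero, pow_one, pow_zero]
    rw [← hsq] at hq1 ⊢
    field_simp
    ring
  · rw [adjSum_radial hG hx]
    have hd : G.dist o x ≠ 0 := (hG.isTree.connected.pos_dist_of_ne (Ne.symm hx)).ne'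
    obtain ⟨d, hd⟩ := Nat.exists_eq_succ_of_ne_zero hd
    simp only [hg]
    rw [hd]
    simp only [Nat.succ_eq_add_one, Nat.add_sub_cancel, pow_succ]
    push_cast
    rw [← hsq] at hq1 ⊢
    field_simp
    ring

/-- On this eigenfunction A / (2 √q) acts as 1, and U_n(1) = n + 1. -/
theorem walkSum_sphericalFun (hG : IsHomogeneousTree G q) (o : V) (n : ℕ) (x : V) :
    walkSum G q (sphericalFun G q o) n x
      = (n + 1) * Real.sqrt q ^ n * sphericalFun G q o x := by
  have hsq : Real.sqrt q ^ 2 = q := Real.sq_sqrt (Nat.cast_nonneg q)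
  induction n using Nat.twoStepInduction generalizing x with
  | zero => simp [walkSum]
  | one =>
    simp only [walkSum, adjSum_sphericalFun hG]
    push_cast
    ring
  | more n ih1 ih2 =>
    simp only [walkSum]
    rw [funext ih2, adjSum_const_mul, ih1, adjSum_sphericalFun hG]
    push_cast
    linear_combination (n + 1) * Real.sqrt q ^ n * sphericalFun G q o x * hsq

theorem le_sphericalFun (hG : IsHomogeneousTree G q) (o x : V) :
    1 / Real.sqrt q ^ G.dist o x ≤ sphericalFun G q o x := by
  unfold sphericalFun
  refine div_le_div_of_nonneg_right ?_ (by positivity)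
  have hq : (1 : ℝ) ≤ q := by exact_mod_cast le_trans one_le_two hG.two_le
  have h : 0 ≤ ((q : ℝ) - 1) / (q + 1) := div_nonneg (by linarith) (by positivity)
  have := mul_nonneg h (Nat.cast_nonneg (α := ℝ) (G.dist o x))
  linarith

theorem weight_eq (G : SimpleGraph V) (q : ℕ) (o : V) (m : ℕ) (x : V) :
    weight G q o m x = (1 + (G.dist o x : ℝ)) ^ m * Real.sqrt q ^ G.dist o x := by
  rw [weight, Real.sqrt_eq_rpow, ← Real.rpow_mul_natCast (Nat.cast_nonneg q)]
  congr 2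
  ring

/-! ### Polynomial growth on the Schwartz space -/

variable {o : V}

/-- Within distance `n` of `x` one has 1 + |x| ≤ (1 + n)(1 + |y|), so decay at `y` becomes decay at
`x`. What remains as a function of `y` is a multiple of the spherical function, to which positivity
applies. -/
theorem norm_toFun_le (hG : IsHomogeneousTree G q) (m n : ℕ) (φ : SchwartzSpace G q o) {x y : V}
    (hxy : G.dist x y ≤ n) :
    ‖φ.toFun y‖ ≤ SchwartzSpace.nu G q o m φ * ((1 + n) / (1 + G.dist o x)) ^ m
      * sphericalFun G q o y := by
  have hs := sqrt_pos hG
  have h1 : weight G q o m y * ‖φ.toFun y‖ ≤ SchwartzSpace.nu G q o m φ := le_ciSup (φ.bddAbove m) y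
  rw [weight_eq] at h1
  have hν : 0 ≤ SchwartzSpace.nu G q o m φ := apply_nonneg _ _
  have hx0 : (0 : ℝ) < 1 + G.dist o x := by positivity
  have hy0 : (0 : ℝ) < 1 + G.dist o y := by positivity
  have h2 : 1 / (1 + (G.dist o y : ℝ)) ≤ (1 + n) / (1 + G.dist o x) := by
    rw [div_le_div_iff₀ hy0 hx0]
    have h3 := hG.isTree.connected.dist_triangle (u := o) (v := y) (w := x)
    rw [SimpleGraph.dist_comm (u := y)] at h3
    have h4 : (G.dist o x : ℝ) ≤ G.dist o y + n := by exact_mod_cast h3.trans (by omega)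
    have := mul_nonneg (Nat.cast_nonneg (α := ℝ) n) (Nat.cast_nonneg (α := ℝ) (G.dist o y))
    nlinarith
  calc ‖φ.toFun y‖
      ≤ SchwartzSpace.nu G q o m φ
          / ((1 + (G.dist o y : ℝ)) ^ m * Real.sqrt q ^ G.dist o y) := by
        rw [le_div_iff₀ (by positivity)]
        linarith
    _ = SchwartzSpace.nu G q o m φ * (1 / (1 + (G.dist o y : ℝ))) ^ m
          * (1 / Real.sqrt q ^ G.dist o y) := by
        rw [one_div_pow]
        field_simp
    _ ≤ _ := by
        refine mul_le_mul ?_ (le_sphericalFun hG o y) (by positivity) (by positivity)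
        exact mul_le_mul_of_nonneg_left (pow_le_pow_left₀ (by positivity) h2 m) hν

theorem walkSum_const_mul {R : Type*} [CommRing R] (c : R) (f : V → R) (n : ℕ) (x : V) :
    walkSum G q (fun y => c * f y) n x = c * walkSum G q f n x := by
  induction n using Nat.twoStepInduction generalizing x with
  | zero => rfl
  | one => exact adjSum_const_mul c f x
  | more n ih1 ih2 =>
    simp only [walkSum]
    rw [funext ih2, adjSum_const_mul, ih1]
    ring

/-- The seminorm of order m + 1 absorbs the factor 1 + |x| in the spherical function. The exponent m
+ 2 is m + 1 from the change of base point, plus one from U_n(1) = n + 1. -/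
theorem weight_mul_norm_walkSum_le (hG : IsHomogeneousTree G q) (m n : ℕ)
    (φ : SchwartzSpace G q o) (x : V) :
    weight G q o m x * ‖walkSum G q φ.toFun n x‖
      ≤ Real.sqrt q ^ n * (SchwartzSpace.nu G q o (m + 1) φ * (1 + n) ^ (m + 2)) := by
  have hs := sqrt_pos hG
  have hν : 0 ≤ SchwartzSpace.nu G q o (m + 1) φ := apply_nonneg _ _
  have hx0 : (0 : ℝ) < 1 + G.dist o x := by positivity
  have h1 := norm_walkSum_le hG n x (fun y hy => norm_toFun_le hG (m + 1) n φ hy)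
  rw [walkSum_const_mul, walkSum_sphericalFun hG] at h1
  have h2 := (h1.trans (mul_le_mul_of_nonneg_left
    (mul_le_mul_of_nonneg_left (sphericalFun_le o x) (by positivity)) (by positivity)))
  have h3 := mul_le_mul_of_nonneg_left h2 (weight_nonneg G q o m x)
  refine h3.trans (le_of_eq ?_)
  rw [weight_eq, div_pow]
  field_simp
  ring

/-- The operator `(1 - 𝓛) / b` on the Schwartz space. -/
def chebyshevOp (hG : IsHomogeneousTree G q) (o : V) (b : ℝ) :
    Module.End ℂ (SchwartzSpace G q o) :=
  (1 / b : ℂ) • (1 - (schwartzLaplacian hG o).toLinearMap)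

theorem chebyshevOp_apply (hG : IsHomogeneousTree G q) (b : ℝ) (φ : SchwartzSpace G q o) :
    chebyshevOp hG o b φ = (1 / b : ℂ) • (φ - schwartzLaplacian hG o φ) := rfl

/-- The Chebyshev polynomials of the second kind of `(1 - 𝓛) / b`. -/
def chebyshevU (hG : IsHomogeneousTree G q) (b : ℝ) (n : ℤ) (φ : SchwartzSpace G q o) :
    SchwartzSpace G q o :=
  Polynomial.aeval (chebyshevOp hG o b) (Polynomial.Chebyshev.U ℂ n) φ

theorem chebyshevU_zero (hG : IsHomogeneousTree G q) (b : ℝ) (φ : SchwartzSpace G q o) :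
    chebyshevU hG b 0 φ = φ := by
  simp [chebyshevU]

theorem chebyshevU_add_one (hG : IsHomogeneousTree G q) (b : ℝ) (n : ℤ)
    (φ : SchwartzSpace G q o) :
    chebyshevU hG b (n + 1) φ
      = (2 : ℂ) • chebyshevOp hG o b (chebyshevU hG b n φ) - chebyshevU hG b (n - 1) φ := by
  unfold chebyshevU
  rw [Polynomial.Chebyshev.U_add_one, map_sub, map_mul, map_mul, Polynomial.aeval_X, map_ofNat,
    LinearMap.sub_apply, mul_assoc, two_smul, two_mul]
  rfl

theorem chebyshevU_neg_one (hG : IsHomogeneousTree G q) (b : ℝ) (φ : SchwartzSpace G q o) :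
    chebyshevU hG b (-1) φ = 0 := by
  simp [chebyshevU]

theorem chebyshevU_neg_sub_two (hG : IsHomogeneousTree G q) (b : ℝ) (n : ℤ)
    (φ : SchwartzSpace G q o) : chebyshevU hG b (-n - 2) φ = -chebyshevU hG b n φ := by
  unfold chebyshevU
  rw [Polynomial.Chebyshev.U_neg_sub_two, map_neg]
  rfl

variable {b : ℝ}

theorem toFun_chebyshevOp (hG : IsHomogeneousTree G q) (hb : b = 2 * Real.sqrt q / (q + 1))
    (φ : SchwartzSpace G q o) (x : V) :
    2 * (Real.sqrt q : ℂ) * (chebyshevOp hG o b φ).toFun x = adjSum G φ.toFun x := by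
  have hs : (Real.sqrt q : ℂ) ≠ 0 := by exact_mod_cast (sqrt_pos hG).ne'
  have hq : (q : ℂ) + 1 ≠ 0 := by exact_mod_cast q.succ_ne_zero
  rw [chebyshevOp_apply, map_smul, map_sub, schwartzLaplacian_toFun]
  simp only [Pi.smul_apply, Pi.sub_apply, laplacian, LinearMap.coe_mk, AddHom.coe_mk, smul_eq_mul,
    adjSum]
  rw [hb]
  push_cast
  field_simp
  ring

theorem toFun_chebyshevU (hG : IsHomogeneousTree G q) (hb : b = 2 * Real.sqrt q / (q + 1))
    (φ : SchwartzSpace G q o) (n : ℕ) (x : V) :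
    (Real.sqrt q : ℂ) ^ n * (chebyshevU hG b n φ).toFun x = walkSum G q φ.toFun n x := by
  have hsq : (Real.sqrt q : ℂ) ^ 2 = q := by
    exact_mod_cast Real.sq_sqrt (Nat.cast_nonneg q)
  induction n using Nat.twoStepInduction generalizing x with
  | zero => simp [chebyshevU_zero, walkSum]
  | one =>
    have h := chebyshevU_add_one hG b 0 φ
    rw [zero_add, zero_sub, chebyshevU_neg_one, sub_zero, chebyshevU_zero] at h
    simp only [walkSum]
    rw [← toFun_chebyshevOp hG hb, Nat.cast_one, h, map_smul, Pi.smul_apply, smul_eq_mul]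
    ring
  | more n ih1 ih2 =>
    have h := chebyshevU_add_one hG b (n + 1) φ
    rw [add_sub_cancel_right, add_assoc, one_add_one_eq_two] at h
    simp only [walkSum]
    rw [← funext ih2, adjSum_const_mul, ← ih1, ← toFun_chebyshevOp hG hb]
    push_cast
    rw [h, map_sub, map_smul, Pi.sub_apply, Pi.smul_apply, smul_eq_mul, ← hsq]
    ring

theorem nu_chebyshevU_natCast_le (hG : IsHomogeneousTree G q)
    (hb : b = 2 * Real.sqrt q / (q + 1)) (m n : ℕ) (φ : SchwartzSpace G q o) :
    SchwartzSpace.nu G q o m (chebyshevU hG b n φ)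
      ≤ SchwartzSpace.nu G q o (m + 1) φ * (1 + (n : ℝ)) ^ (m + 2) := by
  have hs := sqrt_pos hG
  have : Nonempty V := ⟨o⟩
  refine ciSup_le fun x => ?_
  have h1 := weight_mul_norm_walkSum_le hG m n φ x
  rw [← toFun_chebyshevU hG hb, norm_mul, norm_pow, Complex.norm_real, Real.norm_eq_abs,
    abs_of_pos hs] at h1
  refine le_of_mul_le_mul_left ?_ (pow_pos hs n)
  linarith

/-- The recurrence is needed for all integers `n`; negative indices reduce to natural ones by
U_(-n-2) = -U_n, with U_(-1) = 0 between. -/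
theorem nu_chebyshevU_le (hG : IsHomogeneousTree G q) (hb : b = 2 * Real.sqrt q / (q + 1))
    (m : ℕ) (n : ℤ) (φ : SchwartzSpace G q o) :
    SchwartzSpace.nu G q o m (chebyshevU hG b n φ)
      ≤ SchwartzSpace.nu G q o (m + 1) φ * (1 + |(n : ℝ)|) ^ (m + 2) := by
  have hν : 0 ≤ SchwartzSpace.nu G q o (m + 1) φ := apply_nonneg _ _
  rcases le_or_gt 0 n with hn | hn
  · lift n to ℕ using hn
    simpa using nu_chebyshevU_natCast_le hG hb m n φ
  rcases eq_or_ne n (-1) with rfl | hn1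
  · rw [chebyshevU_neg_one, map_zero]
    positivity
  obtain ⟨k, hk⟩ := Int.eq_ofNat_of_zero_le (show 0 ≤ -n - 2 by omega)
  obtain rfl : n = -(k : ℤ) - 2 := by omega
  rw [chebyshevU_neg_sub_two, map_neg_eq_map]
  refine (nu_chebyshevU_natCast_le hG hb m k φ).trans (mul_le_mul_of_nonneg_left ?_ hν)
  refine pow_le_pow_left₀ (by positivity) ?_ _
  push_cast
  rw [abs_of_nonpos (by linarith [Nat.cast_nonneg (α := ℝ) k])]
  linarith

theorem seminorm_chebyshevU_le (hG : IsHomogeneousTree G q) (hb : b = 2 * Real.sqrt q / (q + 1))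
    {ν : Seminorm ℂ (SchwartzSpace G q o)} (hν : Continuous ν) :
    ∃ N : ℕ, ∀ φ, ∃ C : ℝ, ∀ n : ℤ, ν (chebyshevU hG b n φ) ≤ C * (1 + |(n : ℝ)|) ^ N := by
  obtain ⟨s, C, -, hC⟩ := Seminorm.bound_of_continuous SchwartzSpace.withSeminorms ν hν
  refine ⟨s.sup id + 2, fun φ =>
    ⟨C * ∑ i ∈ s, SchwartzSpace.nu G q o (i + 1) φ, fun n => (hC _).trans ?_⟩⟩
  rw [smul_apply, NNReal.smul_def, smul_eq_mul, mul_assoc]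
  have hsum : 0 ≤ ∑ i ∈ s, SchwartzSpace.nu G q o (i + 1) φ :=
    Finset.sum_nonneg fun i _ => apply_nonneg _ _
  refine mul_le_mul_of_nonneg_left ?_ C.2
  refine Seminorm.finset_sup_apply_le (by positivity) fun i hi => ?_
  refine (nu_chebyshevU_le hG hb i n φ).trans ?_
  refine mul_le_mul ?_ ?_ (by positivity) hsum
  · exact Finset.single_le_sum (f := fun i => SchwartzSpace.nu G q o (i + 1) φ)
      (fun i _ => apply_nonneg _ _) hi
  · refine pow_le_pow_right₀ (by linarith [abs_nonneg (n : ℝ)]) ?_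
    have : i ≤ s.sup id := Finset.le_sup (f := id) hi
    omega

/-- This is (√q - 1)² > 0, strict because q ≥ 2. -/
theorem two_mul_sqrt_div_lt_one (hG : IsHomogeneousTree G q) :
    2 * Real.sqrt q / ((q : ℝ) + 1) < 1 := by
  have hsq : Real.sqrt q ^ 2 = q := Real.sq_sqrt (Nat.cast_nonneg q)
  have hq : (2 : ℝ) ≤ q := by exact_mod_cast hG.two_le
  have h1 : Real.sqrt q ≠ 1 := fun h => by rw [h] at hsq; linarith
  rw [div_lt_one (by positivity)]
  nlinarith [sq_pos_of_ne_zero (sub_ne_zero.2 h1)]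

end HomogeneousTree

end

/-! ### Application to the sequence of distributions -/

theorem lemmaA {V : Type*} (G : SimpleGraph V) [G.LocallyFinite] (q : ℕ)
    (hG : HomogeneousTree.IsHomogeneousTree G q) (o : V)
    (T : ℤ → HomogeneousTree.TemperedDistribution G q o)
    (z₀ : ℂ) (hz₀ : z₀ ≠ 0)
    (hT : ∀ k : ℤ, HomogeneousTree.TemperedDistribution.laplacian hG (T k) = z₀ • T (k + 1))
    (ν : Seminorm ℂ (HomogeneousTree.SchwartzSpace G q o)) (hν : Continuous ν)
    (M : ℝ) (hM : 0 < M)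
    (hbound : ∀ (k : ℤ) (φ : HomogeneousTree.SchwartzSpace G q o), ‖T k φ‖ ≤ M * ν φ)
    (b : ℝ) (hb : b = 2 * Real.sqrt q / (q + 1)) :
    (‖z₀‖ ∈ Set.Icc (1 - b) (1 + b) →
      HomogeneousTree.TemperedDistribution.laplacian hG (T 0) = (‖z₀‖ : ℂ) • T 0) ∧
    (‖z₀‖ ∉ Set.Icc (1 - b) (1 + b) → ∀ k : ℤ, T k = 0) := by
  have hb0 : 0 < b := by
    have := HomogeneousTree.sqrt_pos hG
    rw [hb]
    positivity
  have hb1 : b < 1 := hb ▸ HomogeneousTree.two_mul_sqrt_div_lt_one hG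
  have hr : 0 < ‖z₀‖ := norm_pos_iff.2 hz₀
  have hrC : (‖z₀‖ : ℂ) ≠ 0 := by exact_mod_cast hr.ne'
  have hbC : (b : ℂ) ≠ 0 := by exact_mod_cast hb0.ne'
  -- The phase of z₀; rotating T_k by c ^ k replaces z₀ by its modulus and leaves the uniform bound
  -- unchanged.
  set c : ℂ := z₀ / ‖z₀‖ with hc
  have hcz : z₀ = ‖z₀‖ * c := by rw [hc, mul_div_cancel₀ _ hrC]
  have hc1 : ‖c‖ = 1 := by
    rw [hc, norm_div, Complex.norm_real, norm_norm, div_self hr.ne']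
  have hc0 : c ≠ 0 := norm_ne_zero_iff.1 (by rw [hc1]; exact one_ne_zero)
  have hTL : ∀ k φ, T k (HomogeneousTree.schwartzLaplacian hG o φ) = z₀ * T (k + 1) φ :=
    fun k φ => congrArg (fun S : HomogeneousTree.TemperedDistribution G q o => S φ) (hT k)
  obtain ⟨N, hN⟩ := HomogeneousTree.seminorm_chebyshevU_le hG hb hν
  have key : ∀ φ, (∀ k : ℤ, c ^ (k + 1) * T (k + 1) φ = c ^ k * T k φ) ∧
      (‖z₀‖ ∉ Set.Icc (1 - b) (1 + b) → ∀ k, T k φ = 0) := by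
    intro φ
    obtain ⟨C, hC⟩ := hN φ
    obtain ⟨h1, h2⟩ := HomogeneousTree.recurrence_rigidity (N := N) (C := M * C) hb0 hb1 hr
      (v := fun k n => c ^ k * T k (HomogeneousTree.chebyshevU hG b n φ))
      (fun k n => by
        rw [norm_mul, norm_zpow, hc1, one_zpow, one_mul, mul_assoc]
        exact (hbound k _).trans (mul_le_mul_of_nonneg_left (hC n) hM.le))
      (fun k n => by
        rw [HomogeneousTree.chebyshevU_add_one, HomogeneousTree.chebyshevOp_apply, map_sub,
          map_smul, map_smul, map_sub, hTL, zpow_add_one₀ hc0, smul_eq_mul, smul_eq_mul]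
        nth_rewrite 1 [hcz]
        ring)
    refine ⟨fun k => ?_, fun hrn k => ?_⟩
    -- Only n = 0 is needed, as U_0 = 1.
    · simpa only [HomogeneousTree.chebyshevU_zero] using h1 k 0
    · have := h2 hrn k 0
      rw [HomogeneousTree.chebyshevU_zero] at this
      exact (mul_eq_zero.1 this).resolve_left (zpow_ne_zero k hc0)
  refine ⟨fun _ => ?_, fun hrn k => ContinuousLinearMap.ext fun φ => (key φ).2 hrn k⟩
  refine ContinuousLinearMap.ext fun φ => ?_
  have h1 := (key φ).1 0
  have h2 := hTL 0 φ
  rw [zero_add, zpow_one, zpow_zero, one_mul] at h1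
  rw [zero_add, hcz, mul_assoc, h1] at h2
  exact h2
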